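/- Let $p$ be an odd prime, let $m\le k\le 2m$ be non-negative integers, and let $r$ be a unit of $\mathbb{Z}_{p^k}=\mathbb{Z}/p^k\mathbb{Z}$. Write $e(x)=e^{2\pi i x}$. Let $U_{p^k}$ be the Weil representation (attached to $r$) of $SL(2,\mathbb{Z}_{p^k})$ on the space $L^2(\mathbb{Z}_{p^k})$ of functions $\mathbb{Z}_{p^k}\to\mathbb{C}$, that is, the representation which is given on generators by $$U_{p^k}\begin{pmatrix}1&b\\0&1\end{pmatrix}\psi(x)=e\!\left(\frac{rbx^2}{p^k}\right)\psi(x),\qquad U_{p^k}\begin{pmatrix}t&0\\0&t^{-1}\end{pmatrix}\psi(x)=\Lambda(t)\,\psi(tx),$$ $$U_{p^k}\begin{pmatrix}0&1\\-1&0\end{pmatrix}\psi(x)=\frac{S}{\sqrt{p^k}}\sum_{y\in\mathbb{Z}_{p^k}}\psi(y)\,e\!\left(\frac{2rxy}{p^k}\right)$$ for $b\in\mathbb{Z}_{p^k}$ and $t\in\mathbb{Z}_{p^k}^\times$, where $\Lambda(t)=\left(\frac{t}{p}\right)^k$ and $S=p^{-k/2}\sum_{x\in\mathbb{Z}_{p^k}}e(rx^2/p^k)$.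 For $A\in SL(2,\mathbb{Z})$ let $U_{p^k}(A)$ be the operator of the reduction of $A$ modulo $p^k$. Let $S_k(m,k-m)$ be the space of all $f\in L^2(\mathbb{Z}_{p^k})$ such that $f(x)=f(y)$ whenever $p^m\mid x-y$, and $f(x)=0$ whenever $p^{k-m}\nmid x$. Then $S_k(m,k-m)$ is invariant under $U_{p^k}(g)$ for every $g\in SL(2,\mathbb{Z}_{p^k})$, and hence under $U_{p^k}(A)$ for every $A\in SL(2,\mathbb{Z})$. -/

import Mathlib

namespace WeilRep
open Finset

lemma sum_zmod (N : ℕ) [NeZero N] (f : ZMod N → ℂ) :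
    ∑ y, f y = ∑ i ∈ range N, f (i : ZMod N) := by
  refine Finset.sum_nbij' ZMod.val (fun i : ℕ => (i : ZMod N)) ?_ ?_ ?_ ?_ ?_
  · intro a _; simpa using ZMod.val_lt a
  · intro a _; simp
  · intro a _; simp
  · intro a ha; exact ZMod.val_cast_of_lt (by simpa using ha)
  · intro a _; simp

lemma sum_range_periodic (N c : ℕ) [NeZero N] (f : ZMod N → ℂ) :
    ∑ i ∈ range (c * N), f (i : ZMod N) = c * ∑ y, f y := by
  induction c with
  | zero => simp
  | succ c ih =>
    rw [Nat.succ_mul, Finset.sum_range_add, ih, sum_zmod]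
    simp [add_mul]

lemma sum_range_dvd (p M : ℕ) (hp : 0 < p) (f : ℕ → ℂ) :
    ∑ i ∈ range (p * M), (if p ∣ i then f i else 0) = ∑ m ∈ range M, f (p * m) := by
  rw [← Finset.sum_filter]
  symm
  refine Finset.sum_nbij (fun m => p * m) ?_ ?_ ?_ ?_
  · intro a ha
    simp only [mem_filter, mem_range] at ha ⊢
    exact ⟨Nat.mul_lt_mul_of_pos_left ha hp, dvd_mul_right _ _⟩
  · intro a _ b _ h
    exact Nat.eq_of_mul_eq_mul_left hp h
  · intro b hb
    simp only [coe_filter, mem_range, Set.mem_ofPred_eq] at hb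
    obtain ⟨h, m, rfl⟩ := hb
    exact ⟨m, by simpa using Nat.lt_of_mul_lt_mul_left h, rfl⟩
  · intro a _; rfl

lemma sum_quad_step (p : ℕ) [Fact p.Prime] (hp : p ≠ 2) (k : ℕ) (u : ℤ) (hu : ¬ (p : ℤ) ∣ u) :
    ∑ y : ZMod (p ^ (k + 2)), ZMod.stdAddChar ((u : ZMod (p ^ (k + 2))) * y ^ 2) =
      p * ∑ y : ZMod (p ^ k), ZMod.stdAddChar ((u : ZMod (p ^ k)) * y ^ 2) := by
  have pp : p.Prime := Fact.out
  have hp0 : (p : ℂ) ≠ 0 := by exact_mod_cast pp.ne_zero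
  set L := p ^ (k + 2) with hL
  have hw : ∀ y : ℕ, ∑ z ∈ range p,
      ZMod.stdAddChar (N := L) ((2 * u * y * p ^ (k + 1) : ZMod L) * z) =
        if p ∣ y then (p : ℂ) else 0 := by
    intro y
    set w : ℂ := ZMod.stdAddChar (N := L) (2 * u * y * p ^ (k + 1) : ZMod L) with hw
    have h1 : ∀ z : ℕ, ZMod.stdAddChar (N := L) ((2 * u * y * p ^ (k + 1) : ZMod L) * z) = w ^ z := by
      intro z
      rw [hw, ← AddChar.map_nsmul_eq_pow, nsmul_eq_mul, mul_comm]
    simp_rw [h1]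
    have hiff : w = 1 ↔ p ∣ y := by
      rw [hw, ← AddChar.map_zero_eq_one (ZMod.stdAddChar (N := L)),
        ZMod.injective_stdAddChar.eq_iff]
      have : (2 * u * y * p ^ (k + 1) : ZMod L) = ((2 * u * y * p ^ (k + 1) : ℤ) : ZMod L) := by
        push_cast; rfl
      rw [this, ZMod.intCast_zmod_eq_zero_iff_dvd, hL]
      have h2 : ((p ^ (k + 2) : ℕ) : ℤ) = p * p ^ (k + 1) := by push_cast; ring
      rw [h2, mul_dvd_mul_iff_right (by exact_mod_cast pow_ne_zero _ pp.ne_zero)]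
      have hpi : Prime (p : ℤ) := Nat.prime_iff_prime_int.mp pp
      constructor
      · intro h
        rcases hpi.dvd_or_dvd h with h | h
        · rcases hpi.dvd_or_dvd h with h | h
          · exfalso
            have h3 : p ∣ 2 := by exact_mod_cast h
            exact hp ((Nat.prime_dvd_prime_iff_eq pp Nat.prime_two).mp h3)
          · exact absurd h hu
        · exact_mod_cast h
      · intro h
        exact Dvd.dvd.mul_left (by exact_mod_cast h) _
    split_ifs with h
    · rw [hiff.mpr h]; simp
    · have hne : w ≠ 1 := fun h' => h (hiff.mp h')
      rw [geom_sum_eq hne]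
      have : w ^ p = 1 := by
        rw [← h1, ← AddChar.map_zero_eq_one (ZMod.stdAddChar (N := L))]
        congr 1
        have : (p : ZMod L) ^ (k + 2) = 0 := by
          rw [← Nat.cast_pow, ← hL]; simp
        calc (2 * u * y * p ^ (k + 1) : ZMod L) * p = 2 * u * y * p ^ (k + 2) := by ring
          _ = 0 := by rw [this, mul_zero]
      simp [this]
  have h1 : (p : ℂ) * ∑ y : ZMod L, ZMod.stdAddChar ((u : ZMod L) * y ^ 2) =
      ∑ y : ZMod L, ZMod.stdAddChar ((u : ZMod L) * y ^ 2) *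
        ∑ z ∈ range p, ZMod.stdAddChar (N := L) ((2 * u * y * p ^ (k + 1) : ZMod L) * z) := by
    simp_rw [Finset.mul_sum]
    rw [Finset.sum_comm]
    have : ∀ z ∈ range p, ∑ y : ZMod L, ZMod.stdAddChar ((u : ZMod L) * y ^ 2) *
        ZMod.stdAddChar (N := L) ((2 * u * y * p ^ (k + 1) : ZMod L) * z) =
        ∑ y : ZMod L, ZMod.stdAddChar ((u : ZMod L) * y ^ 2) := by
      intro z _
      symm
      rw [← Equiv.sum_comp (Equiv.addRight ((p : ZMod L) ^ (k + 1) * z))]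
      refine Finset.sum_congr rfl fun y _ => ?_
      rw [← AddChar.map_add_eq_mul]
      congr 1
      have h0 : (p : ZMod L) ^ (2 * k + 2) = 0 := by
        have : (p : ZMod L) ^ (k + 2) = 0 := by
          rw [← Nat.cast_pow, ← hL]; simp
        rw [show 2 * k + 2 = (k + 2) + k by ring, pow_add, this, zero_mul]
      simp only [Equiv.coe_addRight]
      linear_combination ((u : ZMod L) * z ^ 2) * h0
    rw [Finset.sum_congr rfl this, Finset.sum_const, card_range, nsmul_eq_mul, Finset.mul_sum]
  apply mul_left_cancel₀ hp0
  rw [h1, sum_zmod]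
  simp_rw [hw, mul_ite, mul_zero]
  rw [show range L = range (p * (p * p ^ k)) by rw [hL]; congr 1; ring]
  rw [sum_range_dvd _ _ pp.pos, ← Finset.sum_mul, mul_comm]
  congr 1
  rw [← sum_range_periodic]
  refine Finset.sum_congr rfl fun m _ => ?_
  have e1 : ((u : ZMod L) * ((p * m : ℕ) : ZMod L) ^ 2) = ((u * (p * m) ^ 2 : ℤ) : ZMod L) := by
    push_cast; ring
  have e2 : ((u : ZMod (p ^ k)) * (m : ZMod (p ^ k)) ^ 2) = ((u * m ^ 2 : ℤ) : ZMod (p ^ k)) := by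
    push_cast; ring
  rw [e1, e2, ZMod.stdAddChar_coe, ZMod.stdAddChar_coe]
  congr 1
  rw [hL]
  push_cast
  field_simp
  ring

lemma sum_quad_prime (p : ℕ) [Fact p.Prime] (hp : p ≠ 2) (u : ZMod p) (hu : u ≠ 0) :
    ∑ y : ZMod p, ZMod.stdAddChar (u * y ^ 2) =
      (quadraticChar (ZMod p) u : ℂ) * ∑ y : ZMod p, ZMod.stdAddChar (y ^ 2) := by
  have key : ∀ v : ZMod p, v ≠ 0 → ∑ y : ZMod p, ZMod.stdAddChar (v * y ^ 2) =
      ∑ x : ZMod p, (quadraticChar (ZMod p) x : ℂ) * ZMod.stdAddChar (v * x) := by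
    intro v hv
    have h1 : ∑ y : ZMod p, ZMod.stdAddChar (v * y ^ 2) =
        ∑ x : ZMod p, ((quadraticChar (ZMod p) x : ℂ) + 1) * ZMod.stdAddChar (v * x) := by
      rw [← Finset.sum_fiberwise (s := Finset.univ) (g := fun y : ZMod p => y ^ 2)]
      refine Finset.sum_congr rfl fun x _ => ?_
      have hc := quadraticChar_card_sqrts ((ZMod.ringChar_zmod_n p).substr hp) x
      have hc' : ((Finset.univ.filter fun y : ZMod p => y ^ 2 = x).card : ℂ) =
          (quadraticChar (ZMod p) x : ℂ) + 1 := by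
        have : (({y : ZMod p | y ^ 2 = x} : Set (ZMod p)).toFinset) =
            Finset.univ.filter fun y : ZMod p => y ^ 2 = x := by ext; simp
        rw [this] at hc
        exact_mod_cast hc
      rw [← hc', ← nsmul_eq_mul, ← Finset.sum_const]
      refine Finset.sum_congr rfl fun y hy => ?_
      rw [(Finset.mem_filter.mp hy).2]
    rw [h1]
    simp_rw [add_mul, one_mul, Finset.sum_add_distrib]
    have := AddChar.sum_mulShift v (ZMod.isPrimitive_stdAddChar p)
    simp_rw [mul_comm _ v] at this
    rw [this]
    simp [hv]
  have h1 := key 1 one_ne_zero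
  simp only [one_mul] at h1
  rw [key u hu, h1, Finset.mul_sum,
    ← Equiv.sum_comp (Equiv.mulLeft₀ u hu) (fun y => _ * (_ * ZMod.stdAddChar y))]
  refine Finset.sum_congr rfl fun x _ => ?_
  have h2 : (quadraticChar (ZMod p) u : ℂ) * (quadraticChar (ZMod p) u : ℂ) = 1 := by
    rw [← Int.cast_mul, ← sq, quadraticChar_sq_one hu]; simp
  simp only [Equiv.mulLeft₀_apply, map_mul, Int.cast_mul]
  rw [← mul_assoc, ← mul_assoc, h2, one_mul]

lemma sum_quad_int (p : ℕ) [Fact p.Prime] (hp : p ≠ 2) (u : ℤ) (hu : ¬ (p : ℤ) ∣ u) :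
    ∀ k : ℕ, ∑ y : ZMod (p ^ k), ZMod.stdAddChar ((u : ZMod (p ^ k)) * y ^ 2) =
      (jacobiSym u (p ^ k) : ℂ) * ∑ y : ZMod (p ^ k), ZMod.stdAddChar (y ^ 2)
  | 0 => by
    have : Subsingleton (ZMod (p ^ 0)) := by rw [pow_zero]; infer_instance
    have hj : jacobiSym u (p ^ 0) = 1 := by rw [pow_zero, jacobiSym.one_right]
    rw [hj, Int.cast_one, one_mul]
    exact Finset.sum_congr rfl fun y _ => congrArg _ (Subsingleton.elim _ _)
  | 1 => by
    have h : ∀ (N : ℕ) [NeZero N], N = p →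
        ∑ y : ZMod N, ZMod.stdAddChar ((u : ZMod N) * y ^ 2) =
          (quadraticChar (ZMod p) (u : ZMod p) : ℂ) * ∑ y : ZMod N, ZMod.stdAddChar (y ^ 2) := by
      intro N _ hN
      subst hN
      exact sum_quad_prime N hp (u : ZMod N)
        (by rwa [Ne, ZMod.intCast_zmod_eq_zero_iff_dvd])
    have hj : (jacobiSym u (p ^ 1)) = quadraticChar (ZMod p) (u : ZMod p) := by
      rw [pow_one, ← jacobiSym.legendreSym.to_jacobiSym]; rfl
    rw [hj]
    exact h _ (pow_one p)
  | k + 2 => by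
    have h1 : ¬ (p : ℤ) ∣ 1 := by
      have := (Fact.out : p.Prime).one_lt
      intro h
      have := Int.le_of_dvd one_pos h
      omega
    have h2 := sum_quad_step p hp k 1 h1
    simp only [Int.cast_one, one_mul] at h2
    rw [sum_quad_step p hp k u hu, sum_quad_int p hp u hu k, h2, pow_add, jacobiSym.mul_right,
      jacobiSym.pow_right u p 2, jacobiSym.sq_one]
    · push_cast; ring
    · rw [Int.gcd_comm]
      exact ((Nat.Prime.coprime_iff_not_dvd (Fact.out : p.Prime)).mpr
        (by rwa [← Int.natCast_dvd]) )

open Matrix MatrixGroups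

section Defs

variable (p k : ℕ) [Fact p.Prime]

/-- `Λ(t) = (t / p) ^ k`, the Jacobi symbol of `t` modulo `p ^ k`. -/
noncomputable def chi (t : ZMod (p ^ k)) : ℂ := (jacobiSym (t.val : ℤ) (p ^ k) : ℂ)

/-- `√(p ^ k)` as a complex number. -/
noncomputable def sqrtN : ℂ := ((√((p : ℝ) ^ k) : ℝ) : ℂ)

variable {p k}

/-- The normalised Gauss sum `p ^ (-k / 2) ∑ₓ e(r x² / p ^ k)`. -/
noncomputable def gaussConst (r : (ZMod (p ^ k))ˣ) : ℂ :=
  (∑ x : ZMod (p ^ k), ZMod.stdAddChar ((r : ZMod (p ^ k)) * x ^ 2)) / sqrtN p k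

/-- The matrix `n_b = (1 b; 0 1)`. -/
def nMat {R : Type*} [CommRing R] (b : R) : SL(2, R) := ⟨!![1, b; 0, 1], by simp⟩

/-- The matrix `a_t = (t 0; 0 t⁻¹)`. -/
def aMat {R : Type*} [CommRing R] (t : Rˣ) : SL(2, R) :=
  ⟨!![(t : R), 0; 0, ((t⁻¹ : Rˣ) : R)], by simp⟩

/-- The matrix `ω = (0 1; -1 0)`. -/
def omegaMat (R : Type*) [CommRing R] : SL(2, R) := ⟨!![0, 1; -1, 0], by simp⟩

/-- The kernel of the Weil representation at `g = (a b; c d)` with `c` a unit. -/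
noncomputable def cellKernel (r : (ZMod (p ^ k))ˣ) (g : SL(2, ZMod (p ^ k))) :
    Matrix (ZMod (p ^ k)) (ZMod (p ^ k)) ℂ :=
  Matrix.of fun x y =>
    gaussConst r * chi p k (-(g 1 0)) / sqrtN p k *
      ZMod.stdAddChar ((r : ZMod (p ^ k)) *
        ((g 1 0)⁻¹ * (g 0 0 * x ^ 2 - 2 * x * y + g 1 1 * y ^ 2)))

open Classical in
/-- The matrix of the Weil representation at `g = (a b; c d)`: the explicit kernel if `c` is a
unit, and `U(ω⁻¹) U(ω g)` otherwise (then `a` is a unit). -/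
noncomputable def weilMatrix (r : (ZMod (p ^ k))ˣ) (g : SL(2, ZMod (p ^ k))) :
    Matrix (ZMod (p ^ k)) (ZMod (p ^ k)) ℂ :=
  if IsUnit (g 1 0) then cellKernel r g
  else cellKernel r (omegaMat _)⁻¹ * cellKernel r (omegaMat _ * g)

end Defs

section Facts

variable {p k : ℕ} [Fact p.Prime]

lemma sqrtN_sq : sqrtN p k * sqrtN p k = ((p ^ k : ℕ) : ℂ) := by
  rw [sqrtN, ← Complex.ofReal_mul, Real.mul_self_sqrt (by positivity)]
  push_cast; rfl

lemma sqrtN_ne : sqrtN p k ≠ 0 := by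
  intro h
  have h1 := sqrtN_sq (p := p) (k := k)
  rw [h, mul_zero] at h1
  have : (p ^ k : ℕ) ≠ 0 := NeZero.ne _
  exact this (by exact_mod_cast h1.symm)

lemma chi_mul (s t : ZMod (p ^ k)) : chi p k (s * t) = chi p k s * chi p k t := by
  unfold chi
  rw [← Int.cast_mul, ← jacobiSym.mul_left]
  congr 1
  apply jacobiSym.mod_left'
  rw [ZMod.val_mul]
  push_cast
  simp

lemma chi_one : chi p k 1 = 1 := by
  have h : chi p k 1 = (jacobiSym 1 (p ^ k) : ℂ) := by
    unfold chi
    congr 1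
    apply jacobiSym.mod_left'
    rw [ZMod.val_one_eq_one_mod]
    push_cast
    simp
  rw [h, jacobiSym.one_left, Int.cast_one]

lemma chi_sq {u : ZMod (p ^ k)} (hu : IsUnit u) : chi p k u * chi p k u = 1 := by
  unfold chi
  rw [← Int.cast_mul, ← sq, jacobiSym.sq_one, Int.cast_one]
  obtain ⟨v, rfl⟩ := hu
  exact ZMod.val_coe_unit_coprime v

lemma sum_quad (hp : p ≠ 2) {u : ZMod (p ^ k)} (hu : IsUnit u) :
    ∑ y : ZMod (p ^ k), ZMod.stdAddChar (u * y ^ 2) =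
      chi p k u * ∑ y : ZMod (p ^ k), ZMod.stdAddChar (y ^ 2) := by
  rcases Nat.eq_zero_or_pos k with rfl | hk
  · have : Subsingleton (ZMod (p ^ 0)) := by rw [pow_zero]; infer_instance
    have hj : chi p 0 u = 1 := by
      rw [Subsingleton.elim u 1, chi_one]
    rw [hj, one_mul]
    exact Finset.sum_congr rfl fun y _ => congrArg _ (Subsingleton.elim _ _)
  · have h : ¬ (p : ℤ) ∣ (u.val : ℤ) := by
      obtain ⟨v, rfl⟩ := hu
      have h1 := (ZMod.val_coe_unit_coprime v).coprime_dvd_right (dvd_pow_self p hk.ne')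
      rw [Int.natCast_dvd_natCast, ← (Fact.out : p.Prime).coprime_iff_not_dvd]
      exact h1.symm
    have := sum_quad_int p hp _ h k
    simpa [chi] using this

lemma isUnit_two' (hp : p ≠ 2) : IsUnit (2 : ZMod (p ^ k)) := by
  have : IsUnit ((2 : ℕ) : ZMod (p ^ k)) := by
    rw [ZMod.isUnit_iff_coprime]
    exact Nat.Coprime.pow_right _
      ((Nat.coprime_primes Nat.prime_two Fact.out).mpr (Ne.symm hp))
  simpa using this

lemma sum_quad_unit (hp : p ≠ 2) (r : (ZMod (p ^ k))ˣ) {u : ZMod (p ^ k)} (hu : IsUnit u) :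
    ∑ y : ZMod (p ^ k), ZMod.stdAddChar ((r : ZMod (p ^ k)) * (u * y ^ 2)) =
      chi p k u * (sqrtN p k * gaussConst r) := by
  have h1 := sum_quad hp (r.isUnit.mul hu)
  simp_rw [mul_assoc] at h1
  rw [h1, gaussConst, mul_div_cancel₀ _ sqrtN_ne, sum_quad hp r.isUnit, chi_mul]
  ring

lemma sum_lin (hp : p ≠ 2) (r : (ZMod (p ^ k))ˣ) (w : ZMod (p ^ k)) :
    ∑ y : ZMod (p ^ k), ZMod.stdAddChar ((r : ZMod (p ^ k)) * (2 * w * y)) =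
      if w = 0 then sqrtN p k * sqrtN p k else 0 := by
  have := AddChar.sum_mulShift ((r : ZMod (p ^ k)) * 2 * w) (ZMod.isPrimitive_stdAddChar (p ^ k))
  have h2 : (r : ZMod (p ^ k)) * 2 * w = 0 ↔ w = 0 :=
    (r.isUnit.mul (isUnit_two' hp)).mul_right_eq_zero
  simp only [h2, ZMod.card] at this
  have h3 : ∀ y : ZMod (p ^ k), (r : ZMod (p ^ k)) * (2 * w * y) = y * (r * 2 * w) := by
    intro y; ring
  simp_rw [h3, this, sqrtN_sq]
  split_ifs <;> simp

lemma gaussConst_sq (hp : p ≠ 2) (r : (ZMod (p ^ k))ˣ) :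
    gaussConst r * gaussConst r = chi p k (-1) := by
  have h1 := sum_quad_unit hp r (isUnit_one (M := ZMod (p ^ k)))
  have h2 := sum_quad_unit hp r (isUnit_one (M := ZMod (p ^ k))).neg
  have h3 : (∑ x : ZMod (p ^ k), ZMod.stdAddChar ((r : ZMod (p ^ k)) * (1 * x ^ 2))) *
      (∑ y : ZMod (p ^ k), ZMod.stdAddChar ((r : ZMod (p ^ k)) * (-1 * y ^ 2))) =
      sqrtN p k * sqrtN p k := by
    rw [Finset.sum_mul_sum, Finset.sum_comm]
    have : ∀ y : ZMod (p ^ k), ∑ x : ZMod (p ^ k),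
        ZMod.stdAddChar ((r : ZMod (p ^ k)) * (1 * x ^ 2)) *
          ZMod.stdAddChar ((r : ZMod (p ^ k)) * (-1 * y ^ 2)) =
        ∑ d : ZMod (p ^ k), ZMod.stdAddChar ((r : ZMod (p ^ k)) * d ^ 2) *
          ZMod.stdAddChar ((r : ZMod (p ^ k)) * (2 * d * y)) := by
      intro y
      rw [← Equiv.sum_comp (Equiv.addRight y)]
      refine Finset.sum_congr rfl fun d _ => ?_
      rw [← AddChar.map_add_eq_mul, ← AddChar.map_add_eq_mul]
      congr 1
      simp only [Equiv.coe_addRight]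
      ring
    simp_rw [this]
    rw [Finset.sum_comm]
    simp_rw [← Finset.mul_sum, sum_lin hp r]
    simp
  rw [h1, h2, chi_one] at h3
  have hs := sqrtN_ne (p := p) (k := k)
  have h4 : chi p k (-1) * (gaussConst r * gaussConst r) = 1 := by
    have : (sqrtN p k * sqrtN p k) * (chi p k (-1) * (gaussConst r * gaussConst r)) =
        (sqrtN p k * sqrtN p k) * 1 := by linear_combination h3
    exact mul_left_cancel₀ (mul_ne_zero hs hs) this
  have h5 := chi_sq (isUnit_one (M := ZMod (p ^ k))).neg
  linear_combination chi p k (-1) * h4 - (gaussConst r * gaussConst r) * h5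

lemma sum_quad_lin (hp : p ≠ 2) (r : (ZMod (p ^ k))ˣ) {u v : ZMod (p ^ k)} (huv : u * v = 1)
    (b : ZMod (p ^ k)) :
    ∑ y : ZMod (p ^ k), ZMod.stdAddChar ((r : ZMod (p ^ k)) * (u * y ^ 2 - 2 * b * y)) =
      ZMod.stdAddChar (-((r : ZMod (p ^ k)) * (b ^ 2 * v))) *
        (chi p k u * (sqrtN p k * gaussConst r)) := by
  rw [← sum_quad_unit hp r (IsUnit.of_mul_eq_one v huv), Finset.mul_sum,
    ← Equiv.sum_comp (Equiv.addRight (b * v))]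
  refine Finset.sum_congr rfl fun y _ => ?_
  rw [← AddChar.map_add_eq_mul]
  congr 1
  simp only [Equiv.coe_addRight]
  linear_combination ((r : ZMod (p ^ k)) * (2 * b * y + b ^ 2 * v)) * huv

lemma cellKernel_apply (r : (ZMod (p ^ k))ˣ) {g : SL(2, ZMod (p ^ k))} {v : ZMod (p ^ k)}
    (h : g 1 0 * v = 1) (x y : ZMod (p ^ k)) :
    cellKernel r g x y = gaussConst r * chi p k (-(g 1 0)) / sqrtN p k *
      ZMod.stdAddChar ((r : ZMod (p ^ k)) *
        (v * (g 0 0 * x ^ 2 - 2 * x * y + g 1 1 * y ^ 2))) := by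
  have hv : (g 1 0)⁻¹ = v := by
    have h1 := ZMod.mul_inv_of_unit _ (IsUnit.of_mul_eq_one v h)
    linear_combination v * h1 - (g 1 0)⁻¹ * h
  simp only [cellKernel, Matrix.of_apply, hv]

lemma cellKernel_mul (hp : p ≠ 2) (r : (ZMod (p ^ k))ˣ) {g h : SL(2, ZMod (p ^ k))}
    (hg : IsUnit (g 1 0)) (hh : IsUnit (h 1 0)) (hgh : IsUnit ((g * h) 1 0)) :
    cellKernel r g * cellKernel r h = cellKernel r (g * h) := by
  obtain ⟨v, hv⟩ := hg.exists_right_inv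
  obtain ⟨v', hv'⟩ := hh.exists_right_inv
  obtain ⟨v'', hv''⟩ := hgh.exists_right_inv
  have e00 : (g * h) 0 0 = g 0 0 * h 0 0 + g 0 1 * h 1 0 := by
    simp [Matrix.mul_apply, Fin.sum_univ_two]
  have e10 : (g * h) 1 0 = g 1 0 * h 0 0 + g 1 1 * h 1 0 := by
    simp [Matrix.mul_apply, Fin.sum_univ_two]
  have e11 : (g * h) 1 1 = g 1 0 * h 0 1 + g 1 1 * h 1 1 := by
    simp [Matrix.mul_apply, Fin.sum_univ_two]
  have dg : g 0 0 * g 1 1 - g 0 1 * g 1 0 = 1 := by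
    rw [← Matrix.det_fin_two]; exact g.2
  have dh : h 0 0 * h 1 1 - h 0 1 * h 1 0 = 1 := by
    rw [← Matrix.det_fin_two]; exact h.2
  ext x z
  rw [Matrix.mul_apply, cellKernel_apply r hv'']
  simp_rw [cellKernel_apply r hv, cellKernel_apply r hv']
  have hu : (v * g 1 1 + v' * h 0 0) * (g 1 0 * h 1 0 * v'') = 1 := by
    rw [e10] at hv''
    linear_combination hv'' + (g 1 1 * h 1 0 * v'') * hv + (g 1 0 * h 0 0 * v'') * hv'
  have hs := sqrtN_ne (p := p) (k := k)
  have hcu : chi p k (v * g 1 1 + v' * h 0 0) = chi p k ((g * h) 1 0) * (chi p k v * chi p k v') := by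
    rw [← chi_mul, ← chi_mul]
    congr 1
    rw [e10]
    linear_combination (-(v * g 1 1)) * hv' - (v' * h 0 0) * hv
  have step : ∀ y : ZMod (p ^ k),
      gaussConst r * chi p k (-(g 1 0)) / sqrtN p k *
        ZMod.stdAddChar ((r : ZMod (p ^ k)) *
          (v * (g 0 0 * x ^ 2 - 2 * x * y + g 1 1 * y ^ 2))) *
      (gaussConst r * chi p k (-(h 1 0)) / sqrtN p k *
        ZMod.stdAddChar ((r : ZMod (p ^ k)) *
          (v' * (h 0 0 * y ^ 2 - 2 * y * z + h 1 1 * z ^ 2)))) =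
      (gaussConst r * chi p k (-(g 1 0)) / sqrtN p k *
        (gaussConst r * chi p k (-(h 1 0)) / sqrtN p k) *
        ZMod.stdAddChar ((r : ZMod (p ^ k)) * (v * g 0 0 * x ^ 2 + v' * h 1 1 * z ^ 2))) *
        ZMod.stdAddChar ((r : ZMod (p ^ k)) *
          ((v * g 1 1 + v' * h 0 0) * y ^ 2 - 2 * (v * x + v' * z) * y)) := by
    intro y
    rw [mul_mul_mul_comm, ← AddChar.map_add_eq_mul, mul_assoc _ (ZMod.stdAddChar _),
      ← AddChar.map_add_eq_mul]
    congr 2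
    ring
  simp_rw [step]
  rw [← Finset.mul_sum, sum_quad_lin hp r hu, hcu]
  have hexp : ZMod.stdAddChar ((r : ZMod (p ^ k)) *
        (v'' * ((g * h) 0 0 * x ^ 2 - 2 * x * z + (g * h) 1 1 * z ^ 2))) =
      ZMod.stdAddChar ((r : ZMod (p ^ k)) * (v * g 0 0 * x ^ 2 + v' * h 1 1 * z ^ 2)) *
        ZMod.stdAddChar
          (-((r : ZMod (p ^ k)) * ((v * x + v' * z) ^ 2 * (g 1 0 * h 1 0 * v'')))) := by
    rw [← AddChar.map_add_eq_mul]
    congr 1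
    rw [e10] at hv''
    have c1 : v * g 0 0 - v ^ 2 * (g 1 0 * h 1 0 * v'') = v'' * (g * h) 0 0 := by
      rw [e00]
      linear_combination (-(v * g 0 0)) * hv'' - (v * h 1 0 * v'') * hv + (v * v'' * h 1 0) * dg
        + (v'' * (g 0 0 * h 0 0 + g 0 1 * h 1 0)) * hv
    have c2 : v' * h 1 1 - v' ^ 2 * (g 1 0 * h 1 0 * v'') = v'' * (g * h) 1 1 := by
      rw [e11]
      linear_combination (-(v' * h 1 1)) * hv'' - (v' * g 1 0 * v'') * hv'
        + (v' * v'' * g 1 0) * dh + (v'' * (g 1 0 * h 0 1 + g 1 1 * h 1 1)) * hv'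
    have c3 : v * v' * (g 1 0 * h 1 0 * v'') = v'' := by
      linear_combination (v'' * h 1 0 * v') * hv + v'' * hv'
    linear_combination (-(r : ZMod (p ^ k)) * x ^ 2) * c1 - ((r : ZMod (p ^ k)) * z ^ 2) * c2
      + (2 * (r : ZMod (p ^ k)) * x * z) * c3
  rw [hexp]
  have q1 := gaussConst_sq hp r
  have q2 := chi_sq (isUnit_one (M := ZMod (p ^ k))).neg
  have n1 : ∀ t : ZMod (p ^ k), chi p k (-t) = chi p k (-1) * chi p k t := by
    intro t; rw [← chi_mul]; congr 1; ring
  have q3 : chi p k (g 1 0) * chi p k v = 1 := by rw [← chi_mul, hv, chi_one]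
  have q4 : chi p k (h 1 0) * chi p k v' = 1 := by rw [← chi_mul, hv', chi_one]
  have key : gaussConst r * chi p k (-(g 1 0)) * (gaussConst r * chi p k (-(h 1 0))) *
      (chi p k ((g * h) 1 0) * (chi p k v * chi p k v')) = chi p k (-((g * h) 1 0)) := by
    rw [n1 (g 1 0), n1 (h 1 0), n1 ((g * h) 1 0)]
    calc _ = (gaussConst r * gaussConst r) * (chi p k (-1) * chi p k (-1)) *
          (chi p k (g 1 0) * chi p k v) * (chi p k (h 1 0) * chi p k v') *
            chi p k ((g * h) 1 0) := by ring
      _ = _ := by rw [q1, q2, q3, q4]; ring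
  rw [← key]
  field_simp

lemma coe_nMat {R : Type*} [CommRing R] (b : R) :
    (nMat b : Matrix (Fin 2) (Fin 2) R) = !![1, b; 0, 1] := rfl

lemma coe_aMat {R : Type*} [CommRing R] (t : Rˣ) :
    (aMat t : Matrix (Fin 2) (Fin 2) R) = !![(t : R), 0; 0, ((t⁻¹ : Rˣ) : R)] := rfl

lemma coe_omegaMat {R : Type*} [CommRing R] :
    (omegaMat R : Matrix (Fin 2) (Fin 2) R) = !![0, 1; -1, 0] := rfl

lemma coe_omegaMat_inv {R : Type*} [CommRing R] :
    ((omegaMat R)⁻¹ : SL(2, R)) = (!![0, -1; 1, 0] : Matrix (Fin 2) (Fin 2) R) := by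
  rw [Matrix.SpecialLinearGroup.coe_inv, coe_omegaMat, Matrix.adjugate_fin_two]
  simp

/-- Multiplication by `e(r b x² / p ^ k)`. -/
noncomputable def diagMat (r : (ZMod (p ^ k))ˣ) (b : ZMod (p ^ k)) :
    Matrix (ZMod (p ^ k)) (ZMod (p ^ k)) ℂ :=
  Matrix.diagonal fun x => ZMod.stdAddChar ((r : ZMod (p ^ k)) * (b * x ^ 2))

lemma cellKernel_nMat_mul (r : (ZMod (p ^ k))ˣ) (b : ZMod (p ^ k)) {g : SL(2, ZMod (p ^ k))}
    (hg : IsUnit (g 1 0)) : cellKernel r (nMat b * g) = diagMat r b * cellKernel r g := by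
  obtain ⟨v, hv⟩ := hg.exists_right_inv
  have e00 : (nMat b * g) 0 0 = g 0 0 + b * g 1 0 := by
    simp [coe_nMat, Matrix.mul_apply, Fin.sum_univ_two]
  have e10 : (nMat b * g) 1 0 = g 1 0 := by simp [coe_nMat, Matrix.mul_apply, Fin.sum_univ_two]
  have e11 : (nMat b * g) 1 1 = g 1 1 := by simp [coe_nMat, Matrix.mul_apply, Fin.sum_univ_two]
  ext x y
  rw [diagMat, Matrix.diagonal_mul, cellKernel_apply r hv, cellKernel_apply r (e10.symm ▸ hv),
    e00, e10, e11, mul_left_comm (ZMod.stdAddChar _), ← AddChar.map_add_eq_mul]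
  congr 2
  linear_combination ((r : ZMod (p ^ k)) * b * x ^ 2) * hv

lemma cellKernel_mul_nMat (r : (ZMod (p ^ k))ˣ) (b : ZMod (p ^ k)) {g : SL(2, ZMod (p ^ k))}
    (hg : IsUnit (g 1 0)) : cellKernel r (g * nMat b) = cellKernel r g * diagMat r b := by
  obtain ⟨v, hv⟩ := hg.exists_right_inv
  have e00 : (g * nMat b) 0 0 = g 0 0 := by simp [coe_nMat, Matrix.mul_apply, Fin.sum_univ_two]
  have e10 : (g * nMat b) 1 0 = g 1 0 := by simp [coe_nMat, Matrix.mul_apply, Fin.sum_univ_two]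
  have e11 : (g * nMat b) 1 1 = g 1 0 * b + g 1 1 := by
    simp [coe_nMat, Matrix.mul_apply, Fin.sum_univ_two]
  ext x y
  rw [diagMat, Matrix.mul_diagonal, cellKernel_apply r hv, cellKernel_apply r (e10.symm ▸ hv),
    e00, e10, e11, mul_assoc _ (ZMod.stdAddChar _), ← AddChar.map_add_eq_mul]
  congr 2
  linear_combination ((r : ZMod (p ^ k)) * b * y ^ 2) * hv

lemma cellKernel_omega_apply (r : (ZMod (p ^ k))ˣ) (x y : ZMod (p ^ k)) :
    cellKernel r (omegaMat _) x y =
      gaussConst r / sqrtN p k * ZMod.stdAddChar ((r : ZMod (p ^ k)) * (2 * x * y)) := by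
  rw [cellKernel_apply (v := -1) r (by simp [coe_omegaMat])]
  simp only [coe_omegaMat, Matrix.of_apply, Matrix.cons_val', Matrix.cons_val_zero,
    Matrix.cons_val_one, Matrix.cons_val_fin_one, neg_neg, chi_one, mul_one]
  congr 2
  ring

lemma cellKernel_omega_inv_apply (r : (ZMod (p ^ k))ˣ) (x y : ZMod (p ^ k)) :
    cellKernel r (omegaMat _)⁻¹ x y = gaussConst r * chi p k (-1) / sqrtN p k *
      ZMod.stdAddChar ((r : ZMod (p ^ k)) * (-(2 * x * y))) := by
  rw [cellKernel_apply (v := 1) r (by rw [coe_omegaMat_inv]; simp)]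
  simp only [coe_omegaMat_inv, Matrix.of_apply, Matrix.cons_val', Matrix.cons_val_zero,
    Matrix.cons_val_one, Matrix.cons_val_fin_one]
  congr 2
  ring

/-- The operator `ψ ↦ ψ(t x)`, multiplied by `Λ(t)`. -/
noncomputable def dilMat (t : ZMod (p ^ k)) : Matrix (ZMod (p ^ k)) (ZMod (p ^ k)) ℂ :=
  Matrix.of fun x z => if z = t * x then chi p k t else 0

lemma cellKernel_inv_mul (hp : p ≠ 2) (r t : (ZMod (p ^ k))ˣ) :
    cellKernel r (omegaMat _)⁻¹ * cellKernel r (omegaMat _ * aMat t) =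
      dilMat (t : ZMod (p ^ k)) := by
  have e00 : (omegaMat (ZMod (p ^ k)) * aMat t) 0 0 = 0 := by
    simp [coe_omegaMat, coe_aMat]
  have e10 : (omegaMat (ZMod (p ^ k)) * aMat t) 1 0 = -t := by
    simp [coe_omegaMat, coe_aMat]
  have e11 : (omegaMat (ZMod (p ^ k)) * aMat t) 1 1 = 0 := by
    simp [coe_omegaMat, coe_aMat]
  have hv : (omegaMat (ZMod (p ^ k)) * aMat t) 1 0 * (-((t⁻¹ : (ZMod (p ^ k))ˣ) : ZMod (p ^ k)))
      = 1 := by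
    rw [e10]; simp
  ext x z
  rw [Matrix.mul_apply]
  simp_rw [cellKernel_omega_inv_apply, cellKernel_apply r hv, e00, e10, e11]
  have step : ∀ y : ZMod (p ^ k),
      gaussConst r * chi p k (-1) / sqrtN p k *
          ZMod.stdAddChar ((r : ZMod (p ^ k)) * (-(2 * x * y))) *
        (gaussConst r * chi p k (- -(t : ZMod (p ^ k))) / sqrtN p k *
          ZMod.stdAddChar ((r : ZMod (p ^ k)) *
            (-((t⁻¹ : (ZMod (p ^ k))ˣ) : ZMod (p ^ k)) *
              (0 * y ^ 2 - 2 * y * z + 0 * z ^ 2)))) =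
      (gaussConst r * chi p k (-1) / sqrtN p k * (gaussConst r * chi p k t / sqrtN p k)) *
        ZMod.stdAddChar ((r : ZMod (p ^ k)) *
          (2 * (((t⁻¹ : (ZMod (p ^ k))ˣ) : ZMod (p ^ k)) * z - x) * y)) := by
    intro y
    rw [mul_mul_mul_comm, ← AddChar.map_add_eq_mul, neg_neg]
    congr 2
    ring
  simp_rw [step]
  rw [← Finset.mul_sum, sum_lin hp r, dilMat, Matrix.of_apply]
  have hiff : ((t⁻¹ : (ZMod (p ^ k))ˣ) : ZMod (p ^ k)) * z - x = 0 ↔ z = t * x := by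
    rw [sub_eq_zero, Units.inv_mul_eq_iff_eq_mul]
  simp only [hiff]
  have hs := sqrtN_ne (p := p) (k := k)
  have q1 := gaussConst_sq hp r
  have q2 := chi_sq (isUnit_one (M := ZMod (p ^ k))).neg
  split_ifs
  · calc _ = (gaussConst r * gaussConst r) * chi p k (-1) * chi p k t := by field_simp
      _ = _ := by rw [q1, q2, one_mul]
  · rw [mul_zero]

lemma aMat_one {R : Type*} [CommRing R] : aMat (1 : Rˣ) = 1 := by
  ext i j; fin_cases i <;> fin_cases j <;> simp [coe_aMat]

lemma dilMat_one : dilMat (1 : ZMod (p ^ k)) = 1 := by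
  ext x z
  simp only [dilMat, Matrix.of_apply, one_mul, chi_one, Matrix.one_apply]
  simp only [eq_comm]

lemma omega_inv_mul_omega (hp : p ≠ 2) (r : (ZMod (p ^ k))ˣ) :
    cellKernel r (omegaMat _)⁻¹ * cellKernel r (omegaMat _) = 1 := by
  have h := cellKernel_inv_mul hp r 1
  rwa [aMat_one, mul_one, Units.val_one, dilMat_one] at h

lemma omega_mul_omega_inv (hp : p ≠ 2) (r : (ZMod (p ^ k))ˣ) :
    cellKernel r (omegaMat _) * cellKernel r (omegaMat _)⁻¹ = 1 :=
  mul_eq_one_comm.mp (omega_inv_mul_omega hp r)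

lemma isUnit_omega : IsUnit ((omegaMat (ZMod (p ^ k))) 1 0) := by
  simp [coe_omegaMat]

lemma weilMatrix_of_isUnit (r : (ZMod (p ^ k))ˣ) {g : SL(2, ZMod (p ^ k))}
    (h : IsUnit (g 1 0)) : weilMatrix r g = cellKernel r g := if_pos h

lemma weilMatrix_of_not (r : (ZMod (p ^ k))ˣ) {g : SL(2, ZMod (p ^ k))}
    (h : ¬ IsUnit (g 1 0)) : weilMatrix r g =
      cellKernel r (omegaMat _)⁻¹ * cellKernel r (omegaMat _ * g) := if_neg h

lemma weilMatrix_omega (r : (ZMod (p ^ k))ˣ) :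
    weilMatrix r (omegaMat _) = cellKernel r (omegaMat _) :=
  weilMatrix_of_isUnit r isUnit_omega

lemma omega_mul_10 (g : SL(2, ZMod (p ^ k))) : (omegaMat (ZMod (p ^ k)) * g) 1 0 = -(g 0 0) := by
  simp [coe_omegaMat, Matrix.mul_apply, Fin.sum_univ_two]

lemma isLocalRing (hk : k ≠ 0) : IsLocalRing (ZMod (p ^ k)) := by
  have : Fact (1 < p ^ k) := ⟨Nat.one_lt_pow hk (Fact.out : p.Prime).one_lt⟩
  exact IsLocalRing.of_surjective' (PadicInt.toZModPow (p := p) k)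
    (ZMod.ringHom_surjective _)

lemma isUnit_of_not (hk : k ≠ 0) {g : SL(2, ZMod (p ^ k))} (h : ¬ IsUnit (g 1 0)) :
    IsUnit (g 0 0) := by
  have := isLocalRing (p := p) hk
  have dg : g 0 0 * g 1 1 + -(g 0 1) * g 1 0 = 1 := by
    have : g 0 0 * g 1 1 - g 0 1 * g 1 0 = 1 := by
      rw [← Matrix.det_fin_two]; exact g.2
    linear_combination this
  rcases IsLocalRing.isUnit_or_isUnit_of_add_one dg with h1 | h1
  · exact isUnit_of_mul_isUnit_left h1
  · exact absurd (isUnit_of_mul_isUnit_right h1) h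

lemma isUnit_sub (hk : k ≠ 0) {a c : ZMod (p ^ k)} (ha : IsUnit a) (hc : ¬ IsUnit c) :
    IsUnit (a - c) := by
  have := isLocalRing (p := p) hk
  by_contra h
  have h1 : a - c ∈ nonunits (ZMod (p ^ k)) := h
  have h2 : c ∈ nonunits (ZMod (p ^ k)) := hc
  have h3 := IsLocalRing.nonunits_add h1 h2
  rw [sub_add_cancel] at h3
  exact h3 ha

lemma weilMatrix_nMat (hp : p ≠ 2) (hk : k ≠ 0) (r : (ZMod (p ^ k))ˣ) (b : ZMod (p ^ k)) :
    weilMatrix r (nMat b) = diagMat r b := by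
  have := isLocalRing (p := p) hk
  rw [weilMatrix_of_not r (by simp [coe_nMat]), cellKernel_mul_nMat r b isUnit_omega,
    ← mul_assoc, omega_inv_mul_omega hp, one_mul]

lemma weilMatrix_aMat (hp : p ≠ 2) (hk : k ≠ 0) (r t : (ZMod (p ^ k))ˣ) :
    weilMatrix r (aMat t) = dilMat (t : ZMod (p ^ k)) := by
  have := isLocalRing (p := p) hk
  rw [weilMatrix_of_not r (by simp [coe_aMat]), cellKernel_inv_mul hp]

lemma weilMatrix_one (hp : p ≠ 2) (hk : k ≠ 0) (r : (ZMod (p ^ k))ˣ) :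
    weilMatrix r 1 = 1 := by
  rw [← aMat_one, weilMatrix_aMat hp hk, Units.val_one, dilMat_one]

lemma weilMatrix_nMat_mul (hp : p ≠ 2) (hk : k ≠ 0) (r : (ZMod (p ^ k))ˣ)
    (g : SL(2, ZMod (p ^ k))) :
    weilMatrix r (nMat 1 * g) = weilMatrix r (nMat 1) * weilMatrix r g := by
  have e10 : (nMat (1 : ZMod (p ^ k)) * g) 1 0 = g 1 0 := by
    simp [coe_nMat, Matrix.mul_apply, Fin.sum_univ_two]
  by_cases hg : IsUnit (g 1 0)
  · rw [weilMatrix_of_isUnit r hg, weilMatrix_of_isUnit r (e10.symm ▸ hg),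
      weilMatrix_nMat hp hk, cellKernel_nMat_mul r 1 hg]
  · have ha := isUnit_of_not hk hg
    rw [weilMatrix_of_not r hg, weilMatrix_of_not r (e10.symm ▸ hg), weilMatrix_nMat hp hk]
    set w := omegaMat (ZMod (p ^ k)) with hw
    have ho : cellKernel r w * cellKernel r w⁻¹ = 1 := omega_mul_omega_inv hp r
    have hoi : cellKernel r w⁻¹ * cellKernel r w = 1 := omega_inv_mul_omega hp r
    have hl : (w * nMat (1 : ZMod (p ^ k)) * w⁻¹) 1 0 = -1 := by
      simp [-Matrix.SpecialLinearGroup.coe_inv, hw, coe_omegaMat, coe_omegaMat_inv, coe_nMat]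
    have hwg : (w * g) 1 0 = -(g 0 0) := omega_mul_10 g
    have hwng : (w * nMat (1 : ZMod (p ^ k)) * w⁻¹ * (w * g)) 1 0 = -(g 0 0 + g 1 0) := by
      rw [mul_assoc, inv_mul_cancel_left, mul_assoc, omega_mul_10]
      simp [coe_nMat, Matrix.mul_apply, Fin.sum_univ_two]
    have h1 : cellKernel r (w * (nMat 1 * g)) =
        cellKernel r (w * nMat (1 : ZMod (p ^ k)) * w⁻¹) * cellKernel r (w * g) := by
      rw [cellKernel_mul hp r]
      · congr 1
        group
      · rw [hl]; exact isUnit_one.neg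
      · rw [hwg]; exact ha.neg
      · rw [hwng]
        have : IsUnit (g 0 0 - -(g 1 0)) := isUnit_sub hk ha (by simpa using hg)
        rw [sub_neg_eq_add] at this
        exact this.neg
    have h2 : cellKernel r (w * nMat (1 : ZMod (p ^ k)) * w⁻¹) * cellKernel r w =
        cellKernel r w * diagMat r 1 := by
      rw [cellKernel_mul hp r, inv_mul_cancel_right, cellKernel_mul_nMat r 1 isUnit_omega]
      · rw [hl]; exact isUnit_one.neg
      · exact isUnit_omega
      · rw [inv_mul_cancel_right]
        simp [hw, coe_omegaMat, coe_nMat]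
    have h3 : cellKernel r (w * nMat (1 : ZMod (p ^ k)) * w⁻¹) =
        cellKernel r w * diagMat r 1 * cellKernel r w⁻¹ := by
      rw [← h2, mul_assoc _ (cellKernel r w), ho, mul_one]
    rw [h1, h3]
    simp only [← mul_assoc]
    rw [hoi, one_mul]

lemma cellKernel_neg (hp : p ≠ 2) (r : (ZMod (p ^ k))ˣ) {g : SL(2, ZMod (p ^ k))}
    (hg : IsUnit (g 1 0)) :
    cellKernel r (omegaMat (ZMod (p ^ k)) * (omegaMat (ZMod (p ^ k)) * g)) =
      cellKernel r (omegaMat _) * (cellKernel r (omegaMat _) * cellKernel r g) := by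
  obtain ⟨v, hv⟩ := hg.exists_right_inv
  have hsq : cellKernel r (omegaMat (ZMod (p ^ k))) * cellKernel r (omegaMat _) =
      dilMat (-1 : ZMod (p ^ k)) := by
    have h := cellKernel_inv_mul hp r (-1)
    have e : omegaMat (ZMod (p ^ k)) * aMat (-1) = (omegaMat _)⁻¹ := by
      ext i j
      rw [coe_omegaMat_inv]
      fin_cases i <;> fin_cases j <;> simp [coe_omegaMat, coe_aMat]
    rw [e] at h
    have h1 := omega_mul_omega_inv hp r
    have h4 : (dilMat (-1) : Matrix (ZMod (p ^ k)) (ZMod (p ^ k)) ℂ) * dilMat (-1) = 1 := by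
      ext x z
      simp only [dilMat, Matrix.mul_apply, Matrix.of_apply, ite_mul, zero_mul,
        Finset.sum_ite_eq', Finset.mem_univ, if_true]
      simp only [mul_ite, mul_zero, Matrix.one_apply,
        chi_sq (isUnit_one (M := ZMod (p ^ k))).neg, neg_mul, one_mul, neg_neg]
      simp only [eq_comm]
    have hd : dilMat (((-1 : (ZMod (p ^ k))ˣ)) : ZMod (p ^ k)) = dilMat (-1 : ZMod (p ^ k)) := by
      simp
    rw [hd] at h
    set a := cellKernel r (omegaMat (ZMod (p ^ k)))
    set b := cellKernel r (omegaMat (ZMod (p ^ k)))⁻¹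
    calc a * a = a * (a * ((b * b) * dilMat (-1))) := by rw [h, h4, mul_one]
      _ = a * ((a * b) * b * dilMat (-1)) := by simp only [mul_assoc]
      _ = (a * b) * dilMat (-1) := by rw [h1, one_mul, ← mul_assoc, h1]
      _ = _ := by rw [h1, one_mul]
  have e00 : (omegaMat (ZMod (p ^ k)) * (omegaMat (ZMod (p ^ k)) * g)) 0 0 = -(g 0 0) := by
    simp [coe_omegaMat, Matrix.vecMul, dotProduct]
  have e10 : (omegaMat (ZMod (p ^ k)) * (omegaMat (ZMod (p ^ k)) * g)) 1 0 = -(g 1 0) := by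
    simp [coe_omegaMat, Matrix.vecMul, dotProduct]
  have e11 : (omegaMat (ZMod (p ^ k)) * (omegaMat (ZMod (p ^ k)) * g)) 1 1 = -(g 1 1) := by
    simp [coe_omegaMat, Matrix.vecMul, dotProduct]
  rw [← mul_assoc (cellKernel r _) (cellKernel r _), hsq]
  ext x y
  rw [cellKernel_apply (v := -v) r (by rw [e10]; linear_combination hv), Matrix.mul_apply]
  simp only [dilMat, Matrix.of_apply, ite_mul, zero_mul, Finset.sum_ite_eq', Finset.mem_univ,
    if_true]
  rw [cellKernel_apply r hv, e00, e10, e11,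
    show -(-(g 1 0)) = (-1) * (-(g 1 0)) by ring, chi_mul]
  have : (r : ZMod (p ^ k)) * (-v * (-(g 0 0) * x ^ 2 - 2 * x * y + -(g 1 1) * y ^ 2)) =
      r * (v * (g 0 0 * (-1 * x) ^ 2 - 2 * (-1 * x) * y + g 1 1 * y ^ 2)) := by ring
  rw [this]
  ring

lemma weilMatrix_omega_mul (hp : p ≠ 2) (r : (ZMod (p ^ k))ˣ)
    (g : SL(2, ZMod (p ^ k))) :
    weilMatrix r (omegaMat _ * g) = weilMatrix r (omegaMat _) * weilMatrix r g := by
  rw [weilMatrix_omega]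
  by_cases hg : IsUnit (g 1 0)
  · rw [weilMatrix_of_isUnit r hg]
    by_cases ha : IsUnit ((omegaMat (ZMod (p ^ k)) * g) 1 0)
    · rw [weilMatrix_of_isUnit r ha, cellKernel_mul hp r isUnit_omega hg ha]
    · rw [weilMatrix_of_not r ha, cellKernel_neg hp r hg, ← mul_assoc, omega_inv_mul_omega hp,
        one_mul]
  · have ha : IsUnit ((omegaMat (ZMod (p ^ k)) * g) 1 0) := by
      rcases eq_or_ne k 0 with rfl | hk
      · have : Subsingleton (ZMod (p ^ 0)) := by rw [pow_zero]; infer_instance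
        exact absurd (isUnit_of_subsingleton _) hg
      · rw [omega_mul_10]; exact (isUnit_of_not hk hg).neg
    rw [weilMatrix_of_isUnit r ha, weilMatrix_of_not r hg, ← mul_assoc,
      omega_mul_omega_inv hp, one_mul]

/-- The elements on which `weilMatrix` is multiplicative from the left. -/
noncomputable def leftMul (hp : p ≠ 2) (hk : k ≠ 0) (r : (ZMod (p ^ k))ˣ) :
    Subgroup SL(2, ZMod (p ^ k)) where
  carrier := {s | ∀ g, weilMatrix r (s * g) = weilMatrix r s * weilMatrix r g}
  one_mem' := by intro g; rw [one_mul, weilMatrix_one hp hk, one_mul]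
  mul_mem' := by
    intro s t hs ht g
    rw [mul_assoc, hs, ht, hs t, mul_assoc]
  inv_mem' := by
    intro s hs g
    have h1 : weilMatrix r s * weilMatrix r s⁻¹ = 1 := by
      rw [← hs, mul_inv_cancel, weilMatrix_one hp hk]
    have h2 := mul_eq_one_comm.mp h1
    calc weilMatrix r (s⁻¹ * g) = weilMatrix r s⁻¹ * (weilMatrix r s * weilMatrix r (s⁻¹ * g)) := by
          rw [← mul_assoc, h2, one_mul]
      _ = _ := by rw [← hs, mul_inv_cancel_left]

lemma nMat_add {R : Type*} [CommRing R] (a b : R) : nMat (a + b) = nMat a * nMat b := by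
  ext i j; fin_cases i <;> fin_cases j <;> simp [coe_nMat, add_comm]

lemma nMat_mem (hp : p ≠ 2) (hk : k ≠ 0) (r : (ZMod (p ^ k))ˣ) (b : ZMod (p ^ k)) :
    nMat b ∈ leftMul hp hk r := by
  have h : ∀ n : ℕ, nMat (n : ZMod (p ^ k)) ∈ leftMul hp hk r := by
    intro n
    induction n with
    | zero =>
      have : nMat ((0 : ℕ) : ZMod (p ^ k)) = 1 := by
        ext i j; fin_cases i <;> fin_cases j <;> simp [coe_nMat]
      rw [this]; exact one_mem _
    | succ n ih =>
      rw [Nat.cast_succ, nMat_add]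
      exact mul_mem ih (fun g => weilMatrix_nMat_mul hp hk r g)
  have := h b.val
  rwa [ZMod.natCast_zmod_val] at this

lemma mem_leftMul (hp : p ≠ 2) (hk : k ≠ 0) (r : (ZMod (p ^ k))ˣ) (g : SL(2, ZMod (p ^ k))) :
    g ∈ leftMul hp hk r := by
  have hw : omegaMat _ ∈ leftMul hp hk r := fun g => weilMatrix_omega_mul hp r g
  have main : ∀ g : SL(2, ZMod (p ^ k)), IsUnit (g 1 0) → g ∈ leftMul hp hk r := by
    intro g hg
    obtain ⟨v, hv⟩ := hg.exists_right_inv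
    have dg : g 0 0 * g 1 1 - g 0 1 * g 1 0 = 1 := by
      rw [← Matrix.det_fin_two]; exact g.2
    have e : g = nMat ((g 0 0 - 1) * v) * (omegaMat _ * nMat (-(g 1 0)) * (omegaMat _)⁻¹) *
        nMat ((g 1 1 - 1) * v) := by
      ext i j
      fin_cases i <;> fin_cases j <;>
        simp [-Matrix.SpecialLinearGroup.coe_inv, coe_nMat, coe_omegaMat, coe_omegaMat_inv]
      · linear_combination (-(g 0 0 - 1)) * hv
      · linear_combination (-v) * dg + (-(g 0 1) - v * (g 0 0 - 1) * (g 1 1 - 1)) * hv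
      · linear_combination (-(g 1 1 - 1)) * hv
    rw [e]
    exact mul_mem (mul_mem (nMat_mem hp hk r _) (mul_mem (mul_mem hw (nMat_mem hp hk r _))
      (inv_mem hw))) (nMat_mem hp hk r _)
  by_cases hg : IsUnit (g 1 0)
  · exact main g hg
  · have h1 : omegaMat _ * g ∈ leftMul hp hk r :=
      main _ (by rw [omega_mul_10]; exact (isUnit_of_not hk hg).neg)
    exact ((leftMul hp hk r).mul_mem_cancel_left hw).mp h1

lemma weilMatrix_zero {r : (ZMod (p ^ 0))ˣ} (g : SL(2, ZMod (p ^ 0))) : weilMatrix r g = 1 := by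
  have : Subsingleton (ZMod (p ^ 0)) := by rw [pow_zero]; infer_instance
  have : Unique (ZMod (p ^ 0)) := uniqueOfSubsingleton 0
  have hs : sqrtN p 0 = 1 := by simp [sqrtN]
  have he : ∀ x : ZMod (p ^ 0), ZMod.stdAddChar x = 1 := by
    intro x; rw [Subsingleton.elim x 0, AddChar.map_zero_eq_one]
  have hc : ∀ x : ZMod (p ^ 0), chi p 0 x = 1 := by
    intro x; rw [Subsingleton.elim x 1, chi_one]
  rw [weilMatrix_of_isUnit r (isUnit_of_subsingleton _)]
  ext x y
  rw [Subsingleton.elim y x, Matrix.one_apply_eq]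
  have h1 : ∑ _x : ZMod (p ^ 0), (1 : ℂ) = 1 := by
    rw [Finset.sum_const, Finset.card_univ, ZMod.card]
    simp
  simp only [cellKernel, Matrix.of_apply, gaussConst, hs, he, hc, h1]
  norm_num

lemma weilMatrix_mul (hp : p ≠ 2) (r : (ZMod (p ^ k))ˣ) (g h : SL(2, ZMod (p ^ k))) :
    weilMatrix r (g * h) = weilMatrix r g * weilMatrix r h := by
  rcases eq_or_ne k 0 with rfl | hk
  · simp only [weilMatrix_zero, mul_one]
  · exact mem_leftMul hp hk r g h

lemma weilMatrix_one' (hp : p ≠ 2) (r : (ZMod (p ^ k))ˣ) : weilMatrix r 1 = 1 := by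
  rcases eq_or_ne k 0 with rfl | hk
  · exact weilMatrix_zero 1
  · exact weilMatrix_one hp hk r

/-- The Weil representation `U_{p^k}` of `SL(2, ℤ / p^k)` on the functions `ℤ / p^k → ℂ`, for an
odd prime `p` and a unit `r`. -/
noncomputable def weilRep (hp : p ≠ 2) (r : (ZMod (p ^ k))ˣ) :
    Representation ℂ SL(2, ZMod (p ^ k)) (ZMod (p ^ k) → ℂ) where
  toFun g := (weilMatrix r g).mulVecLin
  map_one' := by rw [weilMatrix_one' hp, Matrix.mulVecLin_one]; rfl
  map_mul' g h := by rw [weilMatrix_mul hp, Matrix.mulVecLin_mul]; rfl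

/-- `U(n_b) ψ(x) = e(r b x² / p^k) ψ(x)`. -/
theorem weilRep_nMat (hp : p ≠ 2) (r : (ZMod (p ^ k))ˣ) (b : ZMod (p ^ k))
    (ψ : ZMod (p ^ k) → ℂ) (x : ZMod (p ^ k)) :
    weilRep hp r (nMat b) ψ x = ZMod.stdAddChar ((r : ZMod (p ^ k)) * b * x ^ 2) * ψ x := by
  change (weilMatrix r (nMat b) *ᵥ ψ) x = _
  rcases eq_or_ne k 0 with rfl | hk
  · have : Subsingleton (ZMod (p ^ 0)) := by rw [pow_zero]; infer_instance
    rw [weilMatrix_zero, Matrix.one_mulVec, Subsingleton.elim ((r : ZMod (p ^ 0)) * b * x ^ 2) 0,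
      AddChar.map_zero_eq_one, one_mul]
  · rw [weilMatrix_nMat hp hk, diagMat, Matrix.mulVec_diagonal, mul_assoc]

/-- `U(a_t) ψ(x) = Λ(t) ψ(t x)`. -/
theorem weilRep_aMat (hp : p ≠ 2) (r t : (ZMod (p ^ k))ˣ)
    (ψ : ZMod (p ^ k) → ℂ) (x : ZMod (p ^ k)) :
    weilRep hp r (aMat t) ψ x = chi p k t * ψ (t * x) := by
  change (weilMatrix r (aMat t) *ᵥ ψ) x = _
  rcases eq_or_ne k 0 with rfl | hk
  · have : Subsingleton (ZMod (p ^ 0)) := by rw [pow_zero]; infer_instance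
    rw [weilMatrix_zero, Matrix.one_mulVec, Subsingleton.elim (t : ZMod (p ^ 0)) 1, chi_one,
      one_mul, one_mul]
  · rw [weilMatrix_aMat hp hk]
    simp [dilMat, Matrix.mulVec, dotProduct]

/-- `U(ω) ψ(x) = (S / √(p^k)) ∑ y, ψ(y) e(2 r x y / p^k)`, with `S` the normalised Gauss sum. -/
theorem weilRep_omegaMat (hp : p ≠ 2) (r : (ZMod (p ^ k))ˣ)
    (ψ : ZMod (p ^ k) → ℂ) (x : ZMod (p ^ k)) :
    weilRep hp r (omegaMat _) ψ x = gaussConst r / sqrtN p k *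
      ∑ y, ψ y * ZMod.stdAddChar (2 * (r : ZMod (p ^ k)) * x * y) := by
  change (weilMatrix r (omegaMat _) *ᵥ ψ) x = _
  rw [weilMatrix_omega, Matrix.mulVec, dotProduct, Finset.mul_sum]
  refine Finset.sum_congr rfl fun y _ => ?_
  rw [cellKernel_omega_apply,
    show (r : ZMod (p ^ k)) * (2 * x * y) = 2 * r * x * y by ring]
  ring

end Facts

section Main

variable {p k : ℕ} [Fact p.Prime]

/-- `U_{p^k}(A)` for `A ∈ SL(2, ℤ)`: the Weil representation at the reduction of `A`. -/
noncomputable def weilRepInt (hp : p ≠ 2) (r : (ZMod (p ^ k))ˣ) :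
    Representation ℂ SL(2, ℤ) (ZMod (p ^ k) → ℂ) :=
  (weilRep hp r).comp (Matrix.SpecialLinearGroup.map (Int.castRingHom (ZMod (p ^ k))))

/-- `S_k(m, n)`: the functions on `ℤ / p^k` that are `p^m`-periodic and vanish at every `x` that is
not divisible by `p^n`. -/
def schwartzSpace (p k m n : ℕ) : Submodule ℂ (ZMod (p ^ k) → ℂ) where
  carrier := {f | (∀ x y, (p : ZMod (p ^ k)) ^ m ∣ x - y → f x = f y) ∧
    ∀ x, ¬ (p : ZMod (p ^ k)) ^ n ∣ x → f x = 0}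
  zero_mem' := ⟨fun _ _ _ => rfl, fun _ _ => rfl⟩
  add_mem' := by
    rintro f g ⟨hf, hf'⟩ ⟨hg, hg'⟩
    refine ⟨fun x y h => ?_, fun x h => ?_⟩
    · rw [Pi.add_apply, Pi.add_apply, hf x y h, hg x y h]
    · rw [Pi.add_apply, hf' x h, hg' x h, add_zero]
  smul_mem' := by
    rintro c f ⟨hf, hf'⟩
    refine ⟨fun x y h => ?_, fun x h => ?_⟩
    · rw [Pi.smul_apply, Pi.smul_apply, hf x y h]
    · rw [Pi.smul_apply, hf' x h, smul_zero]

end Main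

end WeilRep

open scoped MatrixGroups

open scoped MatrixGroups

namespace WeilRep

section Invariance

variable {p k m : ℕ}

/-! The two conditions that define `schwartzSpace p k m (k - m)` are dual to each other. In `ℤ /
p^k` the ideals `(p^m)` and `(p^(k-m))` are mutual annihilators. The Fourier transform turns
periodicity modulo an ideal into support on its annihilator and support into periodicity, so `ω`,
whose kernel is `e(2rxy / p^k)` up to a constant, maps the space to itself.

The unipotents multiply by `e(rbx² / p^k)`, which preserves the support. For periodicity the phase
must be `p^m`-periodic on that support: if `p^m ∣ x - y` and `p^(k-m)` divides `x` and `y`, then `x²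
- y² = (x - y)(x + y)` lies in the product of the two ideals, which is zero. The inequality `k ≤ 2m`
says that `(p^m) ⊆ (p^(k-m))`, so that the support is a union of cosets of `(p^m)`.

The elements that preserve the space form a submonoid. By `mem_of_nMat_mem_of_omegaMat_mem` it is
the whole group once it contains `ω` and the unipotents; the diagonal matrices need no separate
check. The lemmas that carry the proof are `weilRep_nMat_mem_schwartzSpace` and
`weilRep_omegaMat_mem_schwartzSpace`. -/

lemma natCast_pow_eq_zero : (p : ZMod (p ^ k)) ^ k = 0 := by
  rw [← Nat.cast_pow, ZMod.natCast_self]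

lemma mul_eq_zero_of_pow_dvd (hmk : m ≤ k) {x y : ZMod (p ^ k)}
    (hx : (p : ZMod (p ^ k)) ^ m ∣ x) (hy : (p : ZMod (p ^ k)) ^ (k - m) ∣ y) : x * y = 0 := by
  have h := mul_dvd_mul hx hy
  rwa [← pow_add, Nat.add_sub_cancel' hmk, natCast_pow_eq_zero, zero_dvd_iff] at h

variable [Fact p.Prime]

/-- Converse direction to `mul_eq_zero_of_pow_dvd`: together they make `(p^(k-m))` the exact
annihilator of `p^m`. It is what detects points outside the support in the Fourier argument. -/
lemma pow_dvd_of_mul_pow_eq_zero (hmk : m ≤ k) {x : ZMod (p ^ k)}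
    (h : x * (p : ZMod (p ^ k)) ^ m = 0) : (p : ZMod (p ^ k)) ^ (k - m) ∣ x := by
  -- In general `p^m` cannot be cancelled in `ℤ / p^k`, so the hypothesis is lifted to `p^k ∣ x.val
  -- * p^m` in `ℕ`, where it can.
  rw [← ZMod.natCast_zmod_val x, ← Nat.cast_pow, ← Nat.cast_mul, ZMod.natCast_eq_zero_iff] at h
  have h1 : p ^ (k - m) * p ^ m ∣ x.val * p ^ m := by
    rwa [← pow_add, Nat.sub_add_cancel hmk]
  have h2 := Nat.dvd_of_mul_dvd_mul_right (pow_pos (Fact.out : p.Prime).pos m) h1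
  rw [← ZMod.natCast_zmod_val x, ← Nat.cast_pow]
  exact Nat.cast_dvd_cast h2

/-! ### Invariance under the generators -/

/-- A quadratic phase is not `p^m`-periodic in general, but it is so on the multiples of `p^(k-m)`,
and `f` vanishes elsewhere. -/
lemma weilRep_nMat_mem_schwartzSpace (hp : p ≠ 2) (hmk : m ≤ k) (hkm : k ≤ 2 * m)
    (r : (ZMod (p ^ k))ˣ) (b : ZMod (p ^ k)) {f : ZMod (p ^ k) → ℂ}
    (hf : f ∈ schwartzSpace p k m (k - m)) :
    weilRep hp r (nMat b) f ∈ schwartzSpace p k m (k - m) := by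
  obtain ⟨hper, hsupp⟩ := hf
  refine ⟨fun x y hxy => ?_, fun x hx => ?_⟩
  · rw [weilRep_nMat, weilRep_nMat, hper x y hxy]
    -- Both sides now carry the factor `f y`, so the phases at `x` and `y` need to agree only when
    -- `y` is in the support.
    by_cases hy : (p : ZMod (p ^ k)) ^ (k - m) ∣ y
    -- This is where `k ≤ 2m` enters, as `k - m ≤ m`: `x` lies in the support ideal along with `y`.
    · have hsub : (p : ZMod (p ^ k)) ^ (k - m) ∣ x - y := (pow_dvd_pow _ (by omega)).trans hxy
      have hadd : (p : ZMod (p ^ k)) ^ (k - m) ∣ x + y := by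
        have := dvd_add hsub (hy.mul_left 2)
        rwa [show x - y + 2 * y = x + y by ring] at this
      have h0 := mul_eq_zero_of_pow_dvd hmk hxy hadd
      have hphase : (r : ZMod (p ^ k)) * b * x ^ 2 = r * b * y ^ 2 := by
        linear_combination (r : ZMod (p ^ k)) * b * h0
      rw [hphase]
    · rw [hsupp y hy, mul_zero, mul_zero]
  · rw [weilRep_nMat, hsupp x hx, mul_zero]

/-- Each property of the transform comes from the other property of `f`: its periodicity from the
support of `f`, its support from the periodicity of `f`. This duality does not depend on `k ≤ 2m`.
-/
lemma weilRep_omegaMat_mem_schwartzSpace (hp : p ≠ 2) (hmk : m ≤ k)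
    (r : (ZMod (p ^ k))ˣ) {f : ZMod (p ^ k) → ℂ}
    (hf : f ∈ schwartzSpace p k m (k - m)) :
    weilRep hp r (omegaMat _) f ∈ schwartzSpace p k m (k - m) := by
  obtain ⟨hper, hsupp⟩ := hf
  refine ⟨fun x x' hx => ?_, fun x hx => ?_⟩
  · rw [weilRep_omegaMat, weilRep_omegaMat]
    congr 1
    refine Finset.sum_congr rfl fun y _ => ?_
    by_cases hy : (p : ZMod (p ^ k)) ^ (k - m) ∣ y
    · have h0 := mul_eq_zero_of_pow_dvd hmk hx hy
      have hphase : 2 * (r : ZMod (p ^ k)) * x * y = 2 * r * x' * y := by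
        linear_combination 2 * (r : ZMod (p ^ k)) * h0
      rw [hphase]
    · rw [hsupp y hy, zero_mul, zero_mul]
  · rw [weilRep_omegaMat]
    set S := ∑ y, f y * ZMod.stdAddChar (2 * (r : ZMod (p ^ k)) * x * y) with hS
    -- The factor by which the character `y ↦ e(2rxy / p^k)` changes under `y ↦ y + p^m`. It is
    -- nontrivial because `2r` is a unit, `e` is injective on `ℤ / p^k`, and `x` does not annihilate
    -- `p^m`.
    set w : ℂ := ZMod.stdAddChar (2 * (r : ZMod (p ^ k)) * x * (p : ZMod (p ^ k)) ^ m) with hw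
    have hw1 : w ≠ 1 := by
      rw [hw, ← AddChar.map_zero_eq_one (ZMod.stdAddChar (N := p ^ k)),
        ZMod.injective_stdAddChar.ne_iff, mul_assoc]
      intro h
      exact hx (pow_dvd_of_mul_pow_eq_zero hmk
        (((isUnit_two' hp).mul r.isUnit).mul_right_eq_zero.mp h))
    -- Translating the summation variable by a period `p^m` of `f` multiplies the sum by `w ≠ 1`, so
    -- it vanishes.
    have hshift : S = S * w := by
      conv_lhs => rw [hS, ← Equiv.sum_comp (Equiv.addRight ((p : ZMod (p ^ k)) ^ m))]
      rw [hS, Finset.sum_mul]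
      refine Finset.sum_congr rfl fun y _ => ?_
      rw [Equiv.coe_addRight, hper (y + (p : ZMod (p ^ k)) ^ m) y (by simp), mul_add,
        AddChar.map_add_eq_mul, mul_assoc (f y)]
    have hS0 : S = 0 := by
      have h : S * (w - 1) = 0 := by linear_combination -hshift
      exact (mul_eq_zero.mp h).resolve_right (sub_ne_zero.mpr hw1)
    rw [hS0, mul_zero]

/-! ### Generation of `SL(2, ℤ / p^k)` and conclusion -/

/-- Since `ω⁴ = 1`, a submonoid containing `ω` contains its inverse, so stability of a subspace
under inverses never has to be shown separately. -/
lemma omegaMat_inv_eq {R : Type*} [CommRing R] :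
    (omegaMat R)⁻¹ = omegaMat R * omegaMat R * omegaMat R := by
  ext i j
  fin_cases i <;> fin_cases j <;>
    simp [-Matrix.SpecialLinearGroup.coe_inv, coe_omegaMat, coe_omegaMat_inv]

/-- A submonoid of `SL(2, ℤ / p ^ k)` containing the unipotent matrices and `ω` is everything. -/
lemma mem_of_nMat_mem_of_omegaMat_mem {H : Submonoid SL(2, ZMod (p ^ k))}
    (hn : ∀ b, nMat b ∈ H) (hω : omegaMat _ ∈ H) (g : SL(2, ZMod (p ^ k))) : g ∈ H := by
  have hω' : (omegaMat _)⁻¹ ∈ H := by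
    rw [omegaMat_inv_eq]
    exact mul_mem (mul_mem hω hω) hω
  have hunit : ∀ g : SL(2, ZMod (p ^ k)), IsUnit (g 1 0) → g ∈ H := by
    intro g hg
    obtain ⟨v, hv⟩ := hg.exists_right_inv
    have dg : g 0 0 * g 1 1 - g 0 1 * g 1 0 = 1 := by
      rw [← Matrix.det_fin_two]; exact g.2
    -- With `g = (a b; c d)` and `v = c⁻¹`, the middle factor is the lower unipotent `(1 0; c 1)`.
    -- The outer parameters `(a - 1)/c` and `(d - 1)/c` are forced by the diagonal entries; the
    -- upper right entry then follows from the determinant.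
    have e : g = nMat ((g 0 0 - 1) * v) * (omegaMat _ * nMat (-(g 1 0)) * (omegaMat _)⁻¹) *
        nMat ((g 1 1 - 1) * v) := by
      ext i j
      fin_cases i <;> fin_cases j <;>
        simp [-Matrix.SpecialLinearGroup.coe_inv, coe_nMat, coe_omegaMat, coe_omegaMat_inv]
      · linear_combination (-(g 0 0 - 1)) * hv
      · linear_combination (-v) * dg + (-(g 0 1) - v * (g 0 0 - 1) * (g 1 1 - 1)) * hv
      · linear_combination (-(g 1 1 - 1)) * hv
    rw [e]
    exact mul_mem (mul_mem (hn _) (mul_mem (mul_mem hω (hn _)) hω')) (hn _)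
  by_cases hg : IsUnit (g 1 0)
  · exact hunit g hg
  -- For `k ≠ 0` the ring is local, so if `c` is not a unit then `a` is, and `ω g` has lower left
  -- entry `-a`. For `k = 0` the ring is trivial and every element is a unit.
  · rcases eq_or_ne k 0 with rfl | hk
    · have : Subsingleton (ZMod (p ^ 0)) := by rw [pow_zero]; infer_instance
      exact absurd (isUnit_of_subsingleton _) hg
    · have h := hunit (omegaMat _ * g) (by rw [omega_mul_10]; exact (isUnit_of_not hk hg).neg)
      rw [← inv_mul_cancel_left (omegaMat (ZMod (p ^ k))) g]
      exact mul_mem hω' h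

/-- The elements `g` for which `U(g)` maps the subspace `V` into itself. -/
noncomputable def weilStabilizer (hp : p ≠ 2) (r : (ZMod (p ^ k))ˣ)
    (V : Submodule ℂ (ZMod (p ^ k) → ℂ)) : Submonoid SL(2, ZMod (p ^ k)) where
  carrier := {g | ∀ f ∈ V, weilRep hp r g f ∈ V}
  one_mem' := fun f hf => by rwa [map_one, Module.End.one_apply]
  mul_mem' := fun {g h} hg hh f hf => by
    rw [map_mul, Module.End.mul_apply]
    exact hg _ (hh f hf)

lemma weilRep_mem_schwartzSpace (hp : p ≠ 2) (hmk : m ≤ k) (hkm : k ≤ 2 * m)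
    (r : (ZMod (p ^ k))ˣ) (g : SL(2, ZMod (p ^ k))) :
    ∀ f ∈ schwartzSpace p k m (k - m), weilRep hp r g f ∈ schwartzSpace p k m (k - m) :=
  mem_of_nMat_mem_of_omegaMat_mem
    (H := weilStabilizer hp r (schwartzSpace p k m (k - m)))
    (fun b _ hf => weilRep_nMat_mem_schwartzSpace hp hmk hkm r b hf)
    (fun _ hf => weilRep_omegaMat_mem_schwartzSpace hp hmk r hf) g

end Invariance

end WeilRep

theorem mainTheorem11 (p k m : ℕ) [Fact p.Prime] (hp : p ≠ 2) (hmk : m ≤ k) (hkm : k ≤ 2 * m)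
    (r : (ZMod (p ^ k))ˣ) :
    (∀ g : SL(2, ZMod (p ^ k)), ∀ f ∈ WeilRep.schwartzSpace p k m (k - m),
      WeilRep.weilRep hp r g f ∈ WeilRep.schwartzSpace p k m (k - m)) ∧
    (∀ A : SL(2, ℤ), ∀ f ∈ WeilRep.schwartzSpace p k m (k - m),
      WeilRep.weilRepInt hp r A f ∈ WeilRep.schwartzSpace p k m (k - m)) :=
  ⟨fun g => WeilRep.weilRep_mem_schwartzSpace hp hmk hkm r g,
    -- `weilRepInt` is by definition `weilRep` at the reduction of the integral matrix, which
    -- unification supplies for the last argument.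
    fun _ => WeilRep.weilRep_mem_schwartzSpace hp hmk hkm r _⟩
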